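/- Let $n\ge 1$ and equip $\mathbb{R}^n$ with the Euclidean norm. A set $X\subset\mathbb{R}^n$ is a *Delone set* if it is uniformly discrete (distinct points of $X$ are at distance at least some fixed positive constant) and relatively dense (every point of $\mathbb{R}^n$ is within some fixed finite distance of $X$); its *covering radius* $R$ is the least $\rho$ such that the closed balls of radius $\rho$ centred at the points of $X$ cover $\mathbb{R}^n$. A *Meyer set* is a Delone set $X$ such that $X-X$ is also a Delone set. A Delone set $X$ is an *ideal crystal* if $X=\Lambda+F$ for some full rank lattice $\Lambda\subset\mathbb{R}^n$ and some finite set $F$; otherwise it is *non-crystalline*. For a Delone set $X$, $\mathbf x\in X$ and $T>0$, the *$T$-patch* of $X$ centred at $\mathbf x$ is $\mathcal P_X(\mathbf x;T)=X\cap B(\mathbf x;T)$, where $B(\mathbf x;T)$ is the open ball, and two $T$-patches are *translation-equivalent* if $\mathcal P_X(\mathbf y;T)=\mathcal P_X(\mathbf x;T)+\mathbf y-\mathbf x$. Let $N_X(T)$ be the number (possibly infinite) of translation-inequivalent $T$-patches centred at points of $X$, and let $M_X(T)$ be the least $M$ (possibly infinite) such that every closed ball of radius $M$ contains, for every $\mathbf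 x\in X$, a point $\mathbf y\in X$ whose $T$-patch is translation-equivalent to that of $\mathbf x$. A Delone set $X$ is *linearly repetitive* if there is a constant $c$ such that $M_X(T)<cT$ for all $T\ge 1$. (Since $M_X$ is non-decreasing, the threshold $1$ can be replaced by any other positive number.) **Theorem.** For each $n\ge1$ and each $\epsilon>0$ there exists a non-crystalline Meyer set $X=X(\epsilon)$ in $\mathbb{R}^n$, with covering radius $R$, which is linearly repetitive and has the following properties. (i) There is a $T^*>0$ with $$N_X(T^*)<\Bigl(\frac12+\epsilon\Bigr)\frac{T^*}{R}\quad\text{and}\quad M_X(T^*)<\Bigl(\frac12+\epsilon\Bigr)T^*.$$ (ii) There is a $T_0>0$ such that, for all $T>T_0$, $$N_X(T)<(1+\epsilon)\frac{T}{R}\quad\text{and}\quad M_X(T)<(\tau+1+\epsilon)T,$$ where $\tau=\frac12(1+\sqrt5)$. -/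

import Mathlib

open scoped NNReal ENNReal Pointwise

noncomputable section

namespace PointSet

/-- A subset `X` is a Delone set if it is uniformly discrete (distinct points are at distance
bounded below by a positive constant) and relatively dense (the closed balls of some
fixed radius centred at the points of `X` cover the space). The radii in Mathlib's structure are just
witnesses; the optimal covering radius is `coveringRadius` below. -/
def IsDelone {E : Type*} [NormedAddCommGroup E] (X : Set E) : Prop :=
  ∃ D : Delone.DeloneSet E, D.carrier = X

/-- The covering radius of `X`: the infimum of the radii `ρ` such that the closed balls of radius
`ρ` centred at the points of `X` cover the space (`⊤` if there is no such `ρ`). -/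
def coveringRadius {E : Type*} [NormedAddCommGroup E] (X : Set E) : ℝ≥0∞ :=
  ⨅ (ρ : ℝ≥0) (_ : Metric.IsCover ρ Set.univ X), (ρ : ℝ≥0∞)

/-- A Meyer set is a Delone set `X` whose set of differences `X - X` is also a Delone set. -/
def IsMeyer {E : Type*} [NormedAddCommGroup E] (X : Set E) : Prop :=
  IsDelone X ∧ IsDelone (X - X)

/-- A Delone set `X` is an ideal crystal if `X = Λ + F` with `Λ` a full rank lattice and `F` a
finite set. -/
def IsIdealCrystal {E : Type*} [NormedAddCommGroup E] [NormedSpace ℝ E] (X : Set E) : Prop :=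
  IsDelone X ∧ ∃ (Λ : Submodule ℤ E) (_ : DiscreteTopology Λ) (_ : IsZLattice ℝ Λ) (F : Set E),
    F.Finite ∧ X = (Λ : Set E) + F

/-- The `T`-patch of `X` centred at `x`: the part of `X` in the open ball of radius `T`. -/
def patch {E : Type*} [NormedAddCommGroup E] (X : Set E) (x : E) (T : ℝ) : Set E :=
  X ∩ Metric.ball x T

/-- Translation equivalence of the `T`-patches at `x` and `y`: the translation by `y - x` carries
the first onto the second. -/
def PatchEquiv {E : Type*} [NormedAddCommGroup E] (X : Set E) (T : ℝ) (x y : E) : Prop :=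
  patch X y T = (fun z => z + (y - x)) '' patch X x T

/-- Translation equivalence of `T`-patches as an equivalence relation on the points of `X`. -/
def patchSetoid {E : Type*} [NormedAddCommGroup E] (X : Set E) (T : ℝ) : Setoid X where
  r x y := PatchEquiv X T (x : E) (y : E)
  iseqv :=
    { refl := fun x => by
        change patch X (x : E) T = (fun z => z + ((x : E) - x)) '' patch X (x : E) T
        simp
      symm := fun {x y} h => by
        change patch X (x : E) T = (fun z => z + ((x : E) - y)) '' patch X (y : E) T
        have h' : patch X (y : E) T = (fun z => z + ((y : E) - x)) '' patch X (x : E) T := h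
        rw [h', Set.image_image]
        simp only [add_assoc, sub_add_sub_cancel, sub_self, add_zero, Set.image_id']
      trans := fun {x y z} h₁ h₂ => by
        change patch X (z : E) T = (fun w => w + ((z : E) - x)) '' patch X (x : E) T
        rw [show patch X (z : E) T = _ from h₂, show patch X (y : E) T = _ from h₁,
          Set.image_image]
        congr 1
        funext w
        abel }

/-- The patch-counting function `N_X(T)`: the (possibly infinite) number of
translation-inequivalent `T`-patches centred at points of `X`. -/
def patchCount {E : Type*} [NormedAddCommGroup E] (X : Set E) (T : ℝ) : ℕ∞ :=
  ENat.card (Quotient (patchSetoid X T))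

/-- The repetitivity function `M_X(T)`: the least `M` (possibly infinite) such that every closed
ball of radius `M` contains, for every `x ∈ X`, the centre `y ∈ X` of a `T`-patch that is a
translate of the `T`-patch at `x`. -/
def repetitivity {E : Type*} [NormedAddCommGroup E] (X : Set E) (T : ℝ) : ℝ≥0∞ :=
  ⨅ (M : ℝ≥0) (_ : ∀ b : E, ∀ x ∈ X, ∃ y ∈ X, y ∈ Metric.closedBall b (M : ℝ) ∧
    PatchEquiv X T x y), (M : ℝ≥0∞)

/-- A Delone set `X` is linearly repetitive if `M_X(T)` is bounded by a linear function `c T` for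
`T` bounded away from zero. (For `T` tending to `0` the value `M_X(T)` is the positive covering
radius of `X`, so no linear bound holds there. As `M_X` is non-decreasing, any other positive
threshold in place of `1` gives the same notion.) -/
def IsLinearlyRepetitive {E : Type*} [NormedAddCommGroup E] (X : Set E) : Prop :=
  IsDelone X ∧ ∃ c : ℝ, ∀ T : ℝ, 1 ≤ T → repetitivity X T < ENNReal.ofReal (c * T)

end PointSet

end

/-! The set is essentially one-dimensional: the chain of points `k + δ⌊kφ⌋` in one coordinate, times
a lattice of tiny spacing in the others. For small `δ` all gaps are close to `1`, so `R` is close to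
`1/2` and `T / R` is close to `2T`. A `T`-patch with `T ≤ K + 1` involves only indices within `K` of
its centre, so it is determined by the increments `⌊(k+m)φ⌋ - ⌊kφ⌋`, `|m| ≤ K`.

Counting: these increments are monotone in the fractional part of `kφ`, and each exceeds `⌊mφ⌋` by
`0` or `1`. The patterns thus form a chain under the pointwise order, of at most `2K + 1` elements.

Repetitivity: a pattern recurs when `kφ` modulo one falls in a half-open interval whose endpoints
differ by some `jφ - i` with `|j| ≤ 2K`. If `2K < F_{n+1}`, best approximation gives it length at
least `|ψ|^n`, and any `F_{n+2}` consecutive indices hit such an interval. The balls required have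
radius about `F_{n+2} / 2`; with `F_n ≤ 2K` this is about `(φ + 1)T`. At `T = 1` only `K = 0`
matters, which gives (i).

Irrationality of `φ` excludes periods along the chain. Differences of chain points again have the
chain form up to one bit `δt`, which gives the Meyer property. -/

namespace BeattyChain

open scoped goldenRatio

/-! ### Rational approximation of the golden ratio. -/

/-- Among any `q + q'` consecutive multiples of `α`, some multiple lies modulo one in a given
half-open interval whose length is the larger of the two one-sided approximation errors. -/
theorem exists_int_mul_sub_int_mem_Ico {α u w : ℝ} {q q' : ℕ} {p p' : ℤ}
    (hu : q * α - p = u) (hu0 : 0 < u) (hw : q' * α - p' = -w) (hw0 : 0 < w)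
    (hq : 0 < q + q') (x : ℝ) (s : ℤ) :
    ∃ j i : ℤ, s ≤ j ∧ j < s + q + q' ∧ x ≤ j * α - i ∧ j * α - i < x + max u w := by
  obtain ⟨i₀, hi₀⟩ : ∃ i₀ : ℤ, (s : ℝ) * α - i₀ < x := by
    obtain ⟨i₀, h⟩ := exists_int_gt ((s : ℝ) * α - x)
    exact ⟨i₀, by linarith⟩
  have hmin : 0 < min u w := lt_min hu0 hw0
  have step : ∀ t : ℕ, ∃ j i : ℤ, s ≤ j ∧ j < s + q + q' ∧ j * α - i < x + max u w ∧
      (x ≤ j * α - i ∨ s * α - i₀ + t * min u w ≤ j * α - i) := by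
    intro t
    induction t with
    | zero =>
      refine ⟨s, i₀, le_rfl, by omega, by linarith [le_max_left u w], Or.inr (by simp)⟩
    | succ t ih =>
      obtain ⟨j, i, h1, h2, h3, h4⟩ := ih
      by_cases hx : x ≤ j * α - i
      · exact ⟨j, i, h1, h2, h3, Or.inl hx⟩
      have h4' := h4.resolve_left hx
      rw [not_le] at hx
      -- Adding `q` raises the value by `u`, subtracting `q'` raises it by `w`, and one of the two
      -- always stays in the window of `q + q'` indices. No step exceeds `max u w`, so the walk
      -- cannot jump over the interval.
      by_cases hj : j < s + q'
      · refine ⟨j + q, i + p, by omega, by omega, ?_, Or.inr ?_⟩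
        · push_cast
          linarith [le_max_left u w]
        · push_cast
          linarith [min_le_left u w]
      · refine ⟨j - q', i - p', by omega, by omega, ?_, Or.inr ?_⟩
        · push_cast
          linarith [le_max_right u w]
        · push_cast
          linarith [min_le_right u w]
  obtain ⟨t, ht⟩ := exists_nat_gt ((x + max u w - (s * α - i₀)) / min u w)
  rw [div_lt_iff₀ hmin] at ht
  obtain ⟨j, i, h1, h2, h3, h4⟩ := step t
  exact ⟨j, i, h1, h2, h4.resolve_right (by linarith), h3⟩

theorem fib_mul_goldenRatio_sub (n : ℕ) :
    (Nat.fib n : ℝ) * φ - (Nat.fib (n + 1) : ℤ) = -ψ ^ n := by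
  rw [← Real.fib_succ_sub_goldenRatio_mul_fib]
  push_cast
  ring

/-- Consecutive Fibonacci pairs form a basis of the integer plane, since their determinant is `±1`.
-/
theorem exists_int_eq_fib_combination (n : ℕ) (j i : ℤ) :
    ∃ a b : ℤ, j = a * Nat.fib n + b * Nat.fib (n + 1) ∧
      i = a * Nat.fib (n + 1) + b * Nat.fib (n + 2) := by
  induction n with
  | zero => exact ⟨i - j, j, by simp, by simp⟩
  | succ n ih =>
    obtain ⟨a, b, h1, h2⟩ := ih
    refine ⟨b - a, a, ?_, ?_⟩
    · rw [h1, Nat.fib_add_two (n := n)]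
      push_cast
      ring
    · rw [h2, Nat.fib_add_two (n := n + 1)]
      push_cast
      ring

/-- Best approximation: multiples of `φ` by a nonzero integer of absolute value less than
`fib (n + 1)` stay at distance at least `|ψ| ^ n` from the integers. -/
theorem pow_abs_goldenConj_le (n : ℕ) (j i : ℤ) (hj : j ≠ 0) (hjn : |j| < Nat.fib (n + 1)) :
    |ψ| ^ n ≤ |(j : ℝ) * φ - i| := by
  obtain ⟨a, b, h1, h2⟩ := exists_int_eq_fib_combination n j i
  have hF : (0 : ℤ) < Nat.fib (n + 1) := by exact_mod_cast Nat.fib_pos.2 n.succ_pos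
  have hF' : (0 : ℤ) ≤ Nat.fib n := by positivity
  have hψ := Real.goldenConj_neg
  have hval : (j : ℝ) * φ - i = -(ψ ^ n * (a + b * ψ)) := by
    have e1 := fib_mul_goldenRatio_sub n
    have e2 := fib_mul_goldenRatio_sub (n + 1)
    rw [h1, h2]
    push_cast at e1 e2 ⊢
    rw [pow_succ] at e2
    linear_combination (a : ℝ) * e1 + (b : ℝ) * e2
  rw [hval, abs_neg, abs_mul, abs_pow]
  refine le_mul_of_one_le_right (by positivity) ?_
  rw [abs_lt] at hjn
  -- The bound on `|j|` forces `a ≠ 0` and excludes `a`, `b` of the same sign. As `ψ < 0`, the terms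
  -- `a` and `bψ` then do not cancel, and `|a + bψ| ≥ |a| ≥ 1`.
  rcases lt_trichotomy a 0 with ha | ha | ha
  · have hb : 0 ≤ b := by
      by_contra! hb
      nlinarith
    have ha' : (a : ℝ) ≤ -1 := by exact_mod_cast (by omega : a ≤ -1)
    have hb' : (0 : ℝ) ≤ b := by exact_mod_cast hb
    rw [le_abs]
    right
    nlinarith
  · exfalso
    subst ha
    rcases lt_trichotomy b 0 with hb | hb | hb
    · nlinarith
    · subst hb
      simp at h1
      exact hj h1
    · nlinarith
  · have hb : b ≤ 0 := by
      by_contra! hb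
      nlinarith
    have ha' : (1 : ℝ) ≤ a := by exact_mod_cast ha
    have hb' : (b : ℝ) ≤ 0 := by exact_mod_cast hb
    rw [le_abs]
    left
    nlinarith

/-- The errors of `F_n` and `F_{n+1}` have opposite signs and sizes `|ψ|^n`, `|ψ|^(n+1)`. The parity
of `n` decides which index plays the role of `q`. -/
theorem exists_mul_goldenRatio_mem_Ico (n : ℕ) (x : ℝ) (s : ℤ) :
    ∃ j i : ℤ, s ≤ j ∧ j < s + Nat.fib (n + 2) ∧ x ≤ j * φ - i ∧
      j * φ - i < x + |ψ| ^ n := by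
  have hψ := Real.goldenConj_neg
  have hψ1 : |ψ| ≤ 1 := by
    rw [abs_of_neg hψ]
    linarith [Real.neg_one_lt_goldenConj]
  have hψ0 : 0 < |ψ| := abs_pos.2 hψ.ne
  have hle : |ψ| ^ (n + 1) ≤ |ψ| ^ n := pow_le_pow_of_le_one hψ0.le hψ1 n.le_succ
  have hpos : 0 < Nat.fib n + Nat.fib (n + 1) := by
    have : 0 < Nat.fib (n + 1) := Nat.fib_pos.2 n.succ_pos
    omega
  have e1 := fib_mul_goldenRatio_sub n
  have e2 := fib_mul_goldenRatio_sub (n + 1)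
  have hfib := Nat.fib_add_two (n := n)
  rcases Nat.even_or_odd n with hn | hn
  · have h1 : ψ ^ n = |ψ| ^ n := (hn.pow_abs ψ).symm
    have h2 : ψ ^ (n + 1) = -|ψ| ^ (n + 1) := by
      rw [pow_succ, pow_succ, h1, abs_of_neg hψ]
      ring
    rw [h1] at e1
    rw [h2, neg_neg] at e2
    obtain ⟨j, i, a, b, c, d⟩ := exists_int_mul_sub_int_mem_Ico e2 (by positivity) e1
      (by positivity) (by omega) x s
    rw [max_eq_right hle] at d
    exact ⟨j, i, a, by omega, c, d⟩
  · have h2 : ψ ^ (n + 1) = |ψ| ^ (n + 1) := (hn.add_one.pow_abs ψ).symm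
    have h1 : ψ ^ n = -|ψ| ^ n := by
      rw [abs_of_neg hψ, Odd.neg_pow hn, neg_neg]
    rw [h1, neg_neg] at e1
    rw [h2] at e2
    obtain ⟨j, i, a, b, c, d⟩ := exists_int_mul_sub_int_mem_Ico e1 (by positivity) e2
      (by positivity) (by omega) x s
    rw [max_eq_left hle] at d
    exact ⟨j, i, a, by omega, c, d⟩

/-! ### Patterns of the golden Beatty sequence. -/

/-- The Beatty sequence `⌊k φ⌋` of the golden ratio, over the integers. -/
noncomputable def beatty (k : ℤ) : ℤ := ⌊(k : ℝ) * φ⌋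

theorem beatty_zero : beatty 0 = 0 := by simp [beatty]

/-- The increments at `k` depend on `k` only through the fractional part of `kφ`, and monotonically;
this makes patterns totally ordered. -/
theorem beatty_add_sub (k m : ℤ) :
    beatty (k + m) - beatty k = ⌊(m : ℝ) * φ + Int.fract ((k : ℝ) * φ)⌋ := by
  have h : (m : ℝ) * φ + Int.fract ((k : ℝ) * φ) = ((k + m : ℤ) : ℝ) * φ - beatty k := by
    rw [Int.fract, beatty]
    push_cast
    ring
  rw [h, Int.floor_sub_intCast, beatty, beatty]

theorem beatty_add_mem (k m : ℤ) :
    beatty k + beatty m ≤ beatty (k + m) ∧ beatty (k + m) ≤ beatty k + beatty m + 1 := by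
  have h := beatty_add_sub k m
  have h1 : ⌊(m : ℝ) * φ⌋ ≤ ⌊(m : ℝ) * φ + Int.fract ((k : ℝ) * φ)⌋ :=
    Int.floor_le_floor (by linarith [Int.fract_nonneg ((k : ℝ) * φ)])
  have h2 : ⌊(m : ℝ) * φ + Int.fract ((k : ℝ) * φ)⌋ ≤ ⌊(m : ℝ) * φ + 1⌋ :=
    Int.floor_le_floor (by linarith [Int.fract_lt_one ((k : ℝ) * φ)])
  rw [Int.floor_add_one] at h2
  rw [beatty.eq_1 m]
  omega

theorem beatty_mono : Monotone beatty := fun k l h => by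
  unfold beatty
  have : (k : ℝ) ≤ l := by exact_mod_cast h
  have := Real.goldenRatio_pos
  gcongr

theorem beatty_one : beatty 1 = 1 := by
  rw [beatty, Int.floor_eq_iff]
  push_cast
  constructor <;> linarith [Real.one_lt_goldenRatio, Real.goldenRatio_lt_two]

theorem beatty_sub_le {k l : ℤ} (h : k ≤ l) : beatty l - beatty k ≤ 2 * (l - k) := by
  induction l, h using Int.leInduction with
  | base => simp
  | succ l _ ih =>
    have := (beatty_add_mem l 1).2
    rw [beatty_one] at this
    omega

/-- Any block of `fib (n + 2)` consecutive indices contains an occurrence of any given pattern of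
radius `K` of the golden Beatty sequence, as long as `2 K < fib (n + 1)`. -/
theorem exists_beatty_pattern {K n : ℕ} (hK : 2 * K < Nat.fib (n + 1)) (k s : ℤ) :
    ∃ k' : ℤ, s ≤ k' ∧ k' < s + Nat.fib (n + 2) ∧ ∀ m : ℤ, |m| ≤ K →
      beatty (k' + m) - beatty k' = beatty (k + m) - beatty k := by
  set S : Finset ℤ := Finset.Icc (-(K : ℤ)) K with hS
  have hmem : ∀ m : ℤ, m ∈ S ↔ |m| ≤ K := fun m => by rw [hS, Finset.mem_Icc, abs_le]
  have hne : S.Nonempty := ⟨0, by simp [hmem]⟩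
  -- The pattern at `k` recurs where `k'φ - i` lies between the largest lower and the smallest upper
  -- constraint, attained at `m₁` and `m₂`.
  obtain ⟨m₁, hm₁, hmax⟩ := S.exists_max_image (fun m => (beatty (k + m) : ℝ) - m * φ) hne
  obtain ⟨m₂, hm₂, hmin⟩ := S.exists_min_image (fun m => (beatty (k + m) : ℝ) + 1 - m * φ) hne
  obtain ⟨k', i, h1, h2, h3, h4⟩ :=
    exists_mul_goldenRatio_mem_Ico n ((beatty (k + m₁) : ℝ) - m₁ * φ) s
  have hle : ∀ m : ℤ, (beatty (k + m) : ℝ) ≤ ((k + m : ℤ) : ℝ) * φ := fun m => Int.floor_le _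
  have hlt : ∀ m : ℤ, ((k + m : ℤ) : ℝ) * φ < (beatty (k + m) : ℝ) + 1 := fun m =>
    Int.lt_floor_add_one _
  have hlen : |ψ| ^ n ≤
      ((beatty (k + m₂) : ℝ) + 1 - m₂ * φ) - ((beatty (k + m₁) : ℝ) - m₁ * φ) := by
    -- For `m₁ = m₂` the interval has length exactly `1`; otherwise best approximation applies with
    -- `0 < |m₁ - m₂| ≤ 2K`.
    by_cases hmm : m₁ = m₂
    · subst hmm
      have hψ1 : |ψ| ≤ 1 := by
        rw [abs_of_neg Real.goldenConj_neg]
        linarith [Real.neg_one_lt_goldenConj]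
      have := pow_le_one₀ (n := n) (abs_nonneg ψ) hψ1
      linarith
    · have := pow_abs_goldenConj_le n (m₁ - m₂) (beatty (k + m₁) - (beatty (k + m₂) + 1))
        (sub_ne_zero.2 hmm) (by
          rw [hmem, abs_le] at hm₁ hm₂
          rw [abs_lt]
          omega)
      have e1 := hle m₁
      have e2 := hlt m₂
      push_cast at this e1 e2
      have hpow : 0 ≤ |ψ| ^ n := by positivity
      rcases le_abs.1 this with h | h <;> linarith
  have hfl : ∀ m ∈ S, beatty (k' + m) = beatty (k + m) + i := by
    intro m hm
    have a1 := hmax m hm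
    have a2 := hmin m hm
    rw [beatty, Int.floor_eq_iff]
    push_cast
    constructor <;> linarith
  refine ⟨k', h1, h2, fun m hm => ?_⟩
  have e0 := hfl 0 (by simp [hmem])
  have em := hfl m ((hmem m).2 hm)
  rw [add_zero, add_zero] at e0
  omega

/-- The number of indices at which a pattern of radius `K` exceeds the minimal one. -/
noncomputable def patternWeight (K : ℕ) (k : ℤ) : ℤ :=
  ∑ m ∈ Finset.Icc (-(K : ℤ)) K, (beatty (k + m) - beatty k - beatty m)

theorem patternWeight_mem (K : ℕ) (k : ℤ) :
    patternWeight K k ∈ Finset.Icc (0 : ℤ) (2 * K) := by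
  rw [Finset.mem_Icc]
  constructor
  · exact Finset.sum_nonneg fun m _ => by linarith [(beatty_add_mem k m).1]
  · have h0 : (0 : ℤ) ∈ Finset.Icc (-(K : ℤ)) K := by simp
    rw [patternWeight, ← Finset.add_sum_erase _ _ h0]
    have : ∑ m ∈ (Finset.Icc (-(K : ℤ)) K).erase 0, (beatty (k + m) - beatty k - beatty m) ≤
        ∑ m ∈ (Finset.Icc (-(K : ℤ)) K).erase 0, 1 :=
      Finset.sum_le_sum fun m _ => by linarith [(beatty_add_mem k m).2]
    rw [Finset.sum_const, Finset.card_erase_of_mem h0, Int.card_Icc] at this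
    simp only [add_zero, beatty_zero, nsmul_eq_mul, mul_one] at this ⊢
    omega

/-- A pattern of radius `K` is determined by its weight, since patterns are totally ordered. -/
theorem beatty_pattern_eq_of_patternWeight_eq {K : ℕ} {k k' : ℤ}
    (h : patternWeight K k = patternWeight K k') (m : ℤ) (hm : |m| ≤ K) :
    beatty (k + m) - beatty k = beatty (k' + m) - beatty k' := by
  wlog hkk : Int.fract ((k : ℝ) * φ) ≤ Int.fract ((k' : ℝ) * φ) generalizing k k'
  · exact (this h.symm (le_of_not_ge hkk)).symm
  have hle : ∀ m ∈ Finset.Icc (-(K : ℤ)) K, beatty (k + m) - beatty k - beatty m ≤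
      beatty (k' + m) - beatty k' - beatty m := fun m _ => by
    rw [beatty_add_sub, beatty_add_sub]
    gcongr
  have := (Finset.sum_eq_sum_iff_of_le hle).1 h m (by rwa [Finset.mem_Icc, ← abs_le])
  linarith

/-! ### The chain on the line. -/

/-- The points `k + δ ⌊k φ⌋` of the chain, with gaps `1 + δ` and `1 + 2 δ`. -/
noncomputable def chainPoint (δ : ℝ) (k : ℤ) : ℝ := k + δ * beatty k

theorem chainPoint_zero (δ : ℝ) : chainPoint δ 0 = 0 := by simp [chainPoint, beatty_zero]

section

variable {δ : ℝ}

theorem le_chainPoint_sub (hδ : 0 < δ) {k l : ℤ} (h : k ≤ l) :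
    (l - k : ℝ) ≤ chainPoint δ l - chainPoint δ k := by
  have : (beatty k : ℝ) ≤ beatty l := by exact_mod_cast beatty_mono h
  unfold chainPoint
  nlinarith

theorem chainPoint_sub_le (hδ : 0 < δ) {k l : ℤ} (h : k ≤ l) :
    chainPoint δ l - chainPoint δ k ≤ (1 + 2 * δ) * (l - k) := by
  have : (beatty l - beatty k : ℝ) ≤ 2 * (l - k) := by exact_mod_cast beatty_sub_le h
  unfold chainPoint
  nlinarith

theorem abs_sub_le_abs_chainPoint_sub (hδ : 0 < δ) (k l : ℤ) :
    |(l - k : ℝ)| ≤ |chainPoint δ l - chainPoint δ k| := by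
  rcases le_total k l with h | h
  · have h1 := le_chainPoint_sub hδ h
    have h2 : (k : ℝ) ≤ l := by exact_mod_cast h
    rw [abs_of_nonneg (by linarith), abs_of_nonneg (by linarith)]
    exact h1
  · have h1 := le_chainPoint_sub hδ h
    have h2 : (l : ℝ) ≤ k := by exact_mod_cast h
    rw [abs_of_nonpos (by linarith), abs_of_nonpos (by linarith)]
    linarith

/-- Every closed interval of length `(1 + 2 δ) L` contains `L` consecutive chain points. -/
theorem exists_chainPoint_block (hδ : 0 < δ) (L : ℕ) (b : ℝ) :
    ∃ s : ℤ, ∀ j : ℤ, s ≤ j → j < s + L → |chainPoint δ j - b| ≤ (1 + 2 * δ) * L / 2 := by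
  set M : ℝ := (1 + 2 * δ) * L / 2 with hM
  -- `s` is the first index in or beyond the interval. Its predecessor lies strictly to the left, so
  -- `L` gaps of size at most `1 + 2δ` counted from there stay inside.
  obtain ⟨s, hs, hleast⟩ : ∃ s : ℤ, b - M ≤ chainPoint δ s ∧
      ∀ z : ℤ, b - M ≤ chainPoint δ z → s ≤ z := by
    refine Int.exists_least_of_bdd ?_ ?_
    · obtain ⟨N, hN⟩ := exists_int_le (min (b - M) 0)
      refine ⟨N, fun z hz => ?_⟩
      by_contra! hzN
      have hN0 : N ≤ 0 := by exact_mod_cast hN.trans (min_le_right _ _)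
      have := le_chainPoint_sub hδ (by omega : z ≤ 0)
      rw [chainPoint_zero] at this
      have hzN' : (z : ℝ) < N := by exact_mod_cast hzN
      push_cast at this
      linarith [hN.trans (min_le_left _ _)]
    · obtain ⟨N, hN⟩ := exists_int_ge (max (b - M) 0)
      refine ⟨N, ?_⟩
      have hN0 : 0 ≤ N := by exact_mod_cast (le_max_right _ _).trans hN
      have := le_chainPoint_sub hδ hN0
      rw [chainPoint_zero] at this
      push_cast at this
      linarith [(le_max_left _ _).trans hN]
  refine ⟨s, fun j h1 h2 => ?_⟩
  have hlow := le_chainPoint_sub hδ h1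
  have h1' : (s : ℝ) ≤ j := by exact_mod_cast h1
  have hprev : chainPoint δ (s - 1) < b - M := by
    by_contra! h
    have := hleast _ h
    omega
  have hup := chainPoint_sub_le hδ (by omega : s - 1 ≤ j)
  have h2' : (j : ℝ) + 1 ≤ s + L := by exact_mod_cast h2
  push_cast at hup
  rw [abs_le]
  constructor
  · linarith
  · nlinarith

theorem exists_chainPoint_pattern (hδ : 0 < δ) {K n : ℕ} (hK : 2 * K < Nat.fib (n + 1)) (k : ℤ)
    (b : ℝ) :
    ∃ k' : ℤ, |chainPoint δ k' - b| ≤ (1 + 2 * δ) * Nat.fib (n + 2) / 2 ∧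
      ∀ m : ℤ, |m| ≤ K → beatty (k' + m) - beatty k' = beatty (k + m) - beatty k := by
  obtain ⟨s, hs⟩ := exists_chainPoint_block hδ (Nat.fib (n + 2)) b
  obtain ⟨k', h1, h2, h3⟩ := exists_beatty_pattern hK k s
  exact ⟨k', hs k' h1 h2, h3⟩

theorem exists_chainPoint_near (hδ : 0 < δ) (b : ℝ) :
    ∃ k : ℤ, |chainPoint δ k - b| ≤ 1 / 2 + δ := by
  obtain ⟨s, hs⟩ := exists_chainPoint_block hδ 1 b
  refine ⟨s, (hs s le_rfl (by simp)).trans (le_of_eq ?_)⟩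
  push_cast
  ring

/-- Differences of chain points, described by the index difference and a bit. -/
theorem chainPoint_sub_eq (k l : ℤ) : ∃ t : ℤ, (t = 0 ∨ t = 1) ∧
    chainPoint δ (k + l) - chainPoint δ k = chainPoint δ l + δ * t := by
  refine ⟨beatty (k + l) - beatty k - beatty l, ?_, ?_⟩
  · have := beatty_add_mem k l
    omega
  · unfold chainPoint
    push_cast
    ring

/-- Distinct indices give chain points at least `1 + δ` apart, and a bit can reduce this by at most
`δ`. This carries the uniform discreteness of `X - X`. -/
theorem chainPoint_add_bit_separated (hδ : 0 < δ) (hδ1 : δ ≤ 1) {l l' t t' : ℤ}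
    (ht : t = 0 ∨ t = 1)
    (ht' : t' = 0 ∨ t' = 1) (h : ¬ (l = l' ∧ t = t')) :
    δ ≤ |(chainPoint δ l + δ * t) - (chainPoint δ l' + δ * t')| := by
  wlog hl : l ≤ l' generalizing l l' t t'
  · rw [abs_sub_comm]
    exact this ht' ht (fun h' => h ⟨h'.1.symm, h'.2.symm⟩) (le_of_not_ge hl)
  rcases hl.eq_or_lt with rfl | hl
  · rcases ht with rfl | rfl <;> rcases ht' with rfl | rfl <;> simp_all [le_abs]
  · have h1 : (l : ℝ) + 1 ≤ l' := by exact_mod_cast hl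
    have hb : beatty l + 1 ≤ beatty l' := by
      have := (beatty_add_mem l 1).1
      rw [beatty_one] at this
      exact this.trans (beatty_mono hl)
    have hb' : (beatty l : ℝ) + 1 ≤ beatty l' := by exact_mod_cast hb
    have e1 : (t : ℝ) ≤ 1 := by rcases ht with rfl | rfl <;> simp
    have e2 : (0 : ℝ) ≤ t' := by rcases ht' with rfl | rfl <;> simp
    rw [abs_sub_comm, le_abs]
    left
    unfold chainPoint
    nlinarith

/-- The golden chain has no nonzero translation into itself. -/
theorem eq_zero_of_chainPoint_add (hδ : 0 < δ) (hδ1 : δ ≤ 1) {v : ℝ}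
    (h : ∀ k : ℤ, ∃ k' : ℤ, chainPoint δ k + v = chainPoint δ k') : v = 0 := by
  obtain ⟨m, hm⟩ := h 0
  rw [chainPoint_zero, zero_add] at hm
  -- Separation identifies the translate of the `k`th point as the `(k + m)`th, so `beatty` is
  -- additive along `m`. Iterating makes `mφ` an integer.
  have hstep : ∀ k : ℤ, beatty (k + m) = beatty k + beatty m := by
    intro k
    obtain ⟨k', hk'⟩ := h k
    obtain ⟨t, ht, hkt⟩ := chainPoint_sub_eq (δ := δ) k (k' - k)
    rw [add_sub_cancel] at hkt
    have hsep : k' - k = m ∧ t = 0 := by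
      by_contra hne
      have := chainPoint_add_bit_separated hδ hδ1 ht (Or.inl rfl) hne
      rw [← hkt, ← hk', ← hm] at this
      simp at this
      linarith
    obtain ⟨h1, rfl⟩ := hsep
    obtain rfl : k' = k + m := by omega
    rw [hm, chainPoint, chainPoint, chainPoint] at hk'
    push_cast at hk'
    have : δ * (beatty (k + m) : ℝ) = δ * (beatty k + beatty m) := by linarith
    exact_mod_cast mul_left_cancel₀ hδ.ne' this
  have hmul : ∀ j : ℕ, beatty (j * m) = j * beatty m := by
    intro j
    induction j with
    | zero => simp [beatty_zero]
    | succ j ih =>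
      push_cast
      rw [add_one_mul, hstep, ih]
      ring
  have heq : (m : ℝ) * φ = beatty m := by
    by_contra hne
    have hd : (0 : ℝ) < m * φ - beatty m :=
      sub_pos.2 (lt_of_le_of_ne (Int.floor_le _) (Ne.symm hne))
    obtain ⟨j, hj⟩ := exists_nat_gt (1 / (m * φ - beatty m))
    rw [div_lt_iff₀ hd] at hj
    have := Int.lt_floor_add_one (((j * m : ℤ) : ℝ) * φ)
    rw [← beatty, hmul j] at this
    push_cast at this
    linarith
  have hm0 : m = 0 := by
    by_contra hm0
    refine Real.goldenRatio_irrational ⟨(beatty m : ℚ) / m, ?_⟩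
    have : (m : ℝ) ≠ 0 := by exact_mod_cast hm0
    push_cast
    rw [← heq]
    field_simp
  rw [hm, hm0, chainPoint_zero]

end

/-! ### The layered chain: covering radius, Meyer property, absence of periods. -/

open PointSet

/-- The product of the golden chain in the coordinate `i₀` with the lattice of spacing `η` in the
other coordinates. -/
def layeredChain {ι : Type*} (i₀ : ι) (δ η : ℝ) : Set (EuclideanSpace ℝ ι) :=
  {x | (∃ k : ℤ, x i₀ = chainPoint δ k) ∧ ∀ i, i ≠ i₀ → ∃ z : ℤ, x i = z * η}

variable {ι : Type*} {i₀ : ι} {δ η : ℝ}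

theorem zero_mem_layeredChain : (0 : EuclideanSpace ℝ ι) ∈ layeredChain i₀ δ η :=
  ⟨⟨0, by simp [chainPoint_zero]⟩, fun i _ => ⟨0, by simp⟩⟩

variable [Fintype ι]

theorem abs_coord_sub_le_dist (x y : EuclideanSpace ℝ ι) (i : ι) : |x i - y i| ≤ dist x y := by
  rw [dist_eq_norm]
  simpa using PiLp.norm_apply_le (x - y) i

theorem norm_le_add_card_mul [DecidableEq ι] {x : EuclideanSpace ℝ ι} {r s : ℝ} (hs : 0 ≤ s)
    (h₀ : |x i₀| ≤ r) (h : ∀ i, i ≠ i₀ → |x i| ≤ s) : ‖x‖ ≤ r + Fintype.card ι * s := by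
  have hsum : ‖x‖ ≤ ∑ i, |x i| := by
    have hx : x = ∑ i, EuclideanSpace.single i (x i) := by
      ext j
      simp [Finset.sum_apply]
    calc ‖x‖ = ‖∑ i, EuclideanSpace.single i (x i)‖ := by rw [← hx]
      _ ≤ ∑ i, ‖EuclideanSpace.single i (x i)‖ := norm_sum_le _ _
      _ = ∑ i, |x i| := by simp
  refine hsum.trans ?_
  rw [← Finset.add_sum_erase _ _ (Finset.mem_univ i₀)]
  refine add_le_add h₀ ?_
  calc ∑ i ∈ Finset.univ.erase i₀, |x i| ≤ ∑ i ∈ Finset.univ.erase i₀, s :=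
        Finset.sum_le_sum fun i hi => h i (Finset.ne_of_mem_erase hi)
    _ ≤ ∑ i, s := Finset.sum_le_sum_of_subset_of_nonneg (Finset.subset_univ _) fun _ _ _ => hs
    _ = Fintype.card ι * s := by simp

/-- Every point close to the line coordinate of a chain point is close to a point of the layered
chain lying over that chain point. -/
theorem exists_layeredChain_over [DecidableEq ι] (hη : 0 < η) (b : EuclideanSpace ℝ ι) (k : ℤ)
    {r : ℝ} (hk : |chainPoint δ k - b i₀| ≤ r) :
    ∃ y ∈ layeredChain i₀ δ η, y i₀ = chainPoint δ k ∧
      dist y b ≤ r + Fintype.card ι * η := by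
  let y : EuclideanSpace ℝ ι :=
    WithLp.toLp 2 fun i => if i = i₀ then chainPoint δ k else (round (b i / η) : ℤ) * η
  have hy₀ : y i₀ = chainPoint δ k := by simp [y]
  have hy : ∀ i, i ≠ i₀ → y i = (round (b i / η) : ℤ) * η := fun i hi => by simp [y, hi]
  refine ⟨y, ⟨⟨k, hy₀⟩, fun i hi => ⟨_, hy i hi⟩⟩, hy₀, ?_⟩
  rw [dist_eq_norm]
  refine norm_le_add_card_mul (i₀ := i₀) hη.le (by simpa [hy₀] using hk) fun i hi => ?_
  have h1 := abs_sub_round (b i / η)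
  have h2 : (y - b) i = -((b i / η - round (b i / η)) * η) := by
    rw [PiLp.sub_apply, hy i hi]
    field_simp
    ring
  rw [h2, abs_neg, abs_mul, abs_of_pos hη]
  nlinarith

theorem isCover_layeredChain [DecidableEq ι] (hδ : 0 < δ) (hη : 0 < η) {ρ : ℝ≥0}
    (hρ : 1 / 2 + δ + Fintype.card ι * η ≤ ρ) :
    Metric.IsCover ρ Set.univ (layeredChain i₀ δ η) := by
  intro b _
  obtain ⟨k, hk⟩ := exists_chainPoint_near hδ (b i₀)
  obtain ⟨y, hy, -, hd⟩ := exists_layeredChain_over hη b k hk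
  refine ⟨y, hy, ?_⟩
  have : dist b y ≤ ρ := by
    rw [dist_comm]
    exact hd.trans hρ
  change edist b y ≤ ρ
  rw [edist_nndist]
  exact_mod_cast this

theorem coveringRadius_layeredChain_le [DecidableEq ι] (hδ : 0 < δ) (hη : 0 < η) :
    coveringRadius (layeredChain i₀ δ η) ≤
      ENNReal.ofReal (1 / 2 + δ + Fintype.card ι * η) :=
  iInf₂_le (f := fun (ρ : ℝ≥0) (_ : Metric.IsCover ρ Set.univ (layeredChain i₀ δ η)) =>
    (ρ : ℝ≥0∞)) _ (isCover_layeredChain hδ hη (Real.le_coe_toNNReal _))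

theorem le_coveringRadius_layeredChain [DecidableEq ι] (hδ : 0 < δ) :
    ENNReal.ofReal (1 / 2) ≤ coveringRadius (layeredChain i₀ δ η) := by
  refine le_iInf₂ fun ρ hρ => ?_
  -- The test point has coordinate `1/2` in the gap between the chain points of index `0` and `1`,
  -- which has length at least `1`.
  obtain ⟨y, ⟨⟨k, hk⟩, -⟩, hd⟩ :=
    hρ (Set.mem_univ (EuclideanSpace.single i₀ (1 / 2 : ℝ) : EuclideanSpace ℝ ι))
  have hd' : dist (EuclideanSpace.single i₀ (1 / 2 : ℝ) : EuclideanSpace ℝ ι) y ≤ ρ := by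
    change edist _ y ≤ ρ at hd
    rw [edist_nndist] at hd
    exact_mod_cast hd
  have h1 := (abs_coord_sub_le_dist _ _ i₀).trans hd'
  rw [hk] at h1
  rw [ENNReal.ofReal_le_iff_le_toReal (by simp)]
  refine le_trans ?_ h1
  simp only [PiLp.single_apply, if_true]
  rw [le_abs]
  rcases le_or_gt k 0 with h | h
  · left
    have := le_chainPoint_sub hδ h
    have h' : (k : ℝ) ≤ 0 := by exact_mod_cast h
    rw [chainPoint_zero] at this
    push_cast at this
    linarith
  · right
    have := le_chainPoint_sub hδ h.le
    have h' : (1 : ℝ) ≤ k := by exact_mod_cast h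
    rw [chainPoint_zero] at this
    push_cast at this
    linarith

theorem isSeparated_layeredChain_sub (hδ : 0 < δ) (hδ1 : δ ≤ 1) (hη : 0 < η) {r : ℝ≥0}
    (hrδ : r < δ) (hrη : r < η) :
    Metric.IsSeparated r (layeredChain i₀ δ η - layeredChain i₀ δ η) := by
  rintro _ ⟨x, hx, y, hy, rfl⟩ _ ⟨x', hx', y', hy', rfl⟩ hne
  suffices h : (r : ℝ) < dist (x - y) (x' - y') by
    change (r : ℝ≥0∞) < edist (x - y) (x' - y')
    rw [edist_nndist]
    exact_mod_cast h
  have hcoord : ∃ i, (x - y) i ≠ (x' - y') i := by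
    by_contra! h
    exact hne (by ext i; exact h i)
  obtain ⟨i, hi⟩ := hcoord
  refine lt_of_lt_of_le ?_ (abs_coord_sub_le_dist _ _ i)
  by_cases hi₀ : i = i₀
  · subst hi₀
    refine hrδ.trans_le ?_
    obtain ⟨⟨a, ha⟩, -⟩ := hx
    obtain ⟨⟨b, hb⟩, -⟩ := hy
    obtain ⟨⟨a', ha'⟩, -⟩ := hx'
    obtain ⟨⟨b', hb'⟩, -⟩ := hy'
    obtain ⟨t, ht, h1⟩ := chainPoint_sub_eq (δ := δ) b (a - b)
    obtain ⟨t', ht', h2⟩ := chainPoint_sub_eq (δ := δ) b' (a' - b')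
    rw [add_sub_cancel] at h1 h2
    simp only [PiLp.sub_apply, ha, hb, ha', hb', h1, h2] at hi ⊢
    refine chainPoint_add_bit_separated hδ hδ1 ht ht' ?_
    rintro ⟨e1, e2⟩
    exact hi (by rw [e1, e2])
  · refine hrη.trans_le ?_
    obtain ⟨a, ha⟩ := hx.2 i hi₀
    obtain ⟨b, hb⟩ := hy.2 i hi₀
    obtain ⟨a', ha'⟩ := hx'.2 i hi₀
    obtain ⟨b', hb'⟩ := hy'.2 i hi₀
    simp only [PiLp.sub_apply, ha, hb, ha', hb'] at hi ⊢
    have hz : a - b - (a' - b') ≠ 0 := by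
      intro hz
      apply hi
      have : (a - b : ℝ) = a' - b' := by exact_mod_cast sub_eq_zero.1 hz
      linear_combination η * this
    have h1 : (1 : ℝ) ≤ |(a - b - (a' - b') : ℝ)| := by exact_mod_cast Int.one_le_abs hz
    have h2 : (a * η - b * η - (a' * η - b' * η) : ℝ) = (a - b - (a' - b')) * η := by ring
    rw [h2, abs_mul, abs_of_pos hη]
    nlinarith

theorem isMeyer_layeredChain [DecidableEq ι] (hδ : 0 < δ) (hδ1 : δ ≤ 1) (hη : 0 < η) :
    IsMeyer (layeredChain i₀ δ η) := by
  have hsub : layeredChain i₀ δ η ⊆ layeredChain i₀ δ η - layeredChain i₀ δ η :=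
    fun x hx => ⟨x, hx, 0, zero_mem_layeredChain, sub_zero x⟩
  set r : ℝ≥0 := (min δ η / 2).toNNReal with hr
  have hpos : 0 < min δ η := lt_min hδ hη
  have hr' : (r : ℝ) = min δ η / 2 := Real.coe_toNNReal _ (by positivity)
  have hr0 : 0 < r := by
    rw [hr, Real.toNNReal_pos]
    positivity
  have hsep := isSeparated_layeredChain_sub (i₀ := i₀) hδ hδ1 hη (r := r)
    (by rw [hr']; linarith [min_le_left δ η]) (by rw [hr']; linarith [min_le_right δ η])
  set ρ : ℝ≥0 := (1 / 2 + δ + Fintype.card ι * η).toNNReal with hρ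
  have hρ0 : 0 < ρ := by
    rw [hρ, Real.toNNReal_pos]
    positivity
  have hcov := isCover_layeredChain (i₀ := i₀) hδ hη (Real.le_coe_toNNReal _ : _ ≤ (ρ : ℝ))
  exact ⟨⟨⟨_, r, hr0, hsep.subset hsub, ρ, hρ0, hcov⟩, rfl⟩,
    ⟨⟨_, r, hr0, hsep, ρ, hρ0, hcov.mono hsub⟩, rfl⟩⟩

theorem not_isIdealCrystal_layeredChain [DecidableEq ι] (hδ : 0 < δ) (hδ1 : δ ≤ 1) (hη : 0 < η) :
    ¬ IsIdealCrystal (layeredChain i₀ δ η) := by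
  rintro ⟨-, Λ, _, hΛ, F, -, hX⟩
  -- A lattice vector translates `X` into itself, hence the chain into itself by its coordinate
  -- `i₀`. So `Λ` lies in a hyperplane and cannot have full rank.
  have hzero : ∀ v ∈ Λ, v i₀ = 0 := by
    intro v hv
    refine eq_zero_of_chainPoint_add hδ hδ1 fun k => ?_
    have hk : |chainPoint δ k - (EuclideanSpace.single i₀ (chainPoint δ k) : EuclideanSpace ℝ ι) i₀|
        ≤ 0 := by simp
    obtain ⟨x, hx, hxk, -⟩ := exists_layeredChain_over hη _ k hk
    have hxv : x + v ∈ layeredChain i₀ δ η := by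
      rw [hX] at hx ⊢
      obtain ⟨a, ha, f, hf, rfl⟩ := hx
      exact ⟨a + v, Λ.add_mem ha hv, f, hf, add_right_comm a v f⟩
    obtain ⟨⟨k', hk'⟩, -⟩ := hxv
    exact ⟨k', by rw [← hk', PiLp.add_apply, hxk]⟩
  have hspan : Submodule.span ℝ (Λ : Set (EuclideanSpace ℝ ι)) ≤
      LinearMap.ker (EuclideanSpace.proj i₀ : EuclideanSpace ℝ ι →L[ℝ] ℝ).toLinearMap :=
    Submodule.span_le.2 fun v hv => by simpa using hzero v hv
  rw [hΛ.span_top] at hspan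
  have := hspan (Submodule.mem_top (x := EuclideanSpace.single i₀ (1 : ℝ)))
  simp at this

/-! ### Patch counting and repetitivity. -/

theorem add_sub_mem_patch_layeredChain (hδ : 0 < δ) {K : ℕ} {T : ℝ} (hT : T ≤ K + 1)
    {x y : EuclideanSpace ℝ ι} (hx : x ∈ layeredChain i₀ δ η) (hy : y ∈ layeredChain i₀ δ η)
    {k k' : ℤ} (hk : x i₀ = chainPoint δ k) (hk' : y i₀ = chainPoint δ k')
    (h : ∀ m : ℤ, |m| ≤ K → beatty (k' + m) - beatty k' = beatty (k + m) - beatty k)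
    {z : EuclideanSpace ℝ ι} (hz : z ∈ patch (layeredChain i₀ δ η) x T) :
    z + (y - x) ∈ patch (layeredChain i₀ δ η) y T := by
  obtain ⟨⟨⟨l, hl⟩, hz'⟩, hzT⟩ := hz
  rw [Metric.mem_ball] at hzT
  refine ⟨⟨⟨k' + (l - k), ?_⟩, fun i hi => ?_⟩, ?_⟩
  · have h1 := (abs_coord_sub_le_dist z x i₀).trans_lt (hzT.trans_le hT)
    rw [hl, hk] at h1
    have h2 := (abs_sub_le_abs_chainPoint_sub hδ k l).trans_lt h1
    -- The ball is open, so `|l - k| < K + 1` strictly; this is why `T ≤ K + 1` suffices.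
    have h3 : |l - k| ≤ K := by
      have : |l - k| < (K : ℤ) + 1 := by exact_mod_cast h2
      omega
    have h4 := h (l - k) h3
    rw [add_sub_cancel] at h4
    have h5 : (beatty (k' + (l - k)) : ℝ) = beatty l - beatty k + beatty k' := by
      exact_mod_cast (by omega : beatty (k' + (l - k)) = beatty l - beatty k + beatty k')
    rw [PiLp.add_apply, PiLp.sub_apply, hl, hk, hk', chainPoint, chainPoint, chainPoint,
      chainPoint, h5]
    push_cast
    ring
  · obtain ⟨a, ha⟩ := hz' i hi
    obtain ⟨b, hb⟩ := hy.2 i hi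
    obtain ⟨c, hc⟩ := hx.2 i hi
    refine ⟨a + (b - c), ?_⟩
    rw [PiLp.add_apply, PiLp.sub_apply, ha, hb, hc]
    push_cast
    ring
  · rw [Metric.mem_ball, dist_eq_norm] at *
    convert hzT using 2
    abel

theorem patchEquiv_layeredChain (hδ : 0 < δ) {K : ℕ} {T : ℝ} (hT : T ≤ K + 1)
    {x y : EuclideanSpace ℝ ι} (hx : x ∈ layeredChain i₀ δ η) (hy : y ∈ layeredChain i₀ δ η)
    {k k' : ℤ} (hk : x i₀ = chainPoint δ k) (hk' : y i₀ = chainPoint δ k')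
    (h : ∀ m : ℤ, |m| ≤ K → beatty (k' + m) - beatty k' = beatty (k + m) - beatty k) :
    PatchEquiv (layeredChain i₀ δ η) T x y := by
  ext w
  constructor
  · intro hw
    exact ⟨w + (x - y), add_sub_mem_patch_layeredChain hδ hT hy hx hk' hk
      (fun m hm => (h m hm).symm) hw, by
        change w + (x - y) + (y - x) = w
        abel⟩
  · rintro ⟨z, hz, rfl⟩
    exact add_sub_mem_patch_layeredChain hδ hT hx hy hk hk' h hz

theorem patchCount_layeredChain_le (hδ : 0 < δ) {K : ℕ} {T : ℝ} (hT : T ≤ K + 1) :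
    patchCount (layeredChain i₀ δ η) T ≤ (2 * K + 1 : ℕ) := by
  choose idx hidx using fun x : layeredChain i₀ δ η => x.2.1
  let f : Quotient (patchSetoid (layeredChain i₀ δ η) T) → Finset.Icc (0 : ℤ) (2 * K) :=
    fun q => ⟨patternWeight K (idx q.out), patternWeight_mem K _⟩
  have hf : Function.Injective f := by
    intro q q' h
    have hw : patternWeight K (idx q.out) = patternWeight K (idx q'.out) := congrArg Subtype.val h
    rw [← q.out_eq, ← q'.out_eq]
    exact Quotient.sound (patchEquiv_layeredChain hδ hT q.out.2 q'.out.2 (hidx _) (hidx _)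
      (beatty_pattern_eq_of_patternWeight_eq hw.symm))
  refine (ENat.card_le_card_of_injective hf).trans (le_of_eq ?_)
  rw [ENat.card_eq_coe_fintype_card, Fintype.card_coe, Int.card_Icc]
  congr 1

theorem repetitivity_layeredChain_le [DecidableEq ι] (hδ : 0 < δ) (hη : 0 < η) {K n : ℕ} {T : ℝ}
    (hT : T ≤ K + 1) (hK : 2 * K < Nat.fib (n + 1)) :
    repetitivity (layeredChain i₀ δ η) T ≤
      ENNReal.ofReal ((1 + 2 * δ) * Nat.fib (n + 2) / 2 + Fintype.card ι * η) := by
  refine iInf₂_le _ fun b x hx => ?_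
  obtain ⟨k, hk⟩ := hx.1
  obtain ⟨k', hk', hpat⟩ := exists_chainPoint_pattern hδ hK k (b i₀)
  obtain ⟨y, hy, hyk, hd⟩ := exists_layeredChain_over hη b k' hk'
  exact ⟨y, hy, hd.trans (Real.le_coe_toNNReal _), patchEquiv_layeredChain hδ hT hx hy hk hyk hpat⟩

theorem fib_add_two_le (n : ℕ) :
    (Nat.fib (n + 2) : ℝ) ≤ (φ + 1) * Nat.fib n + 1 := by
  have h := Real.fib_succ_sub_goldenRatio_mul_fib n
  have hψ : ψ ^ n ≤ 1 := by
    refine (le_abs_self _).trans ?_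
    rw [abs_pow, abs_of_neg Real.goldenConj_neg]
    exact pow_le_one₀ (by linarith [Real.goldenConj_neg])
      (by linarith [Real.neg_one_lt_goldenConj])
  rw [Nat.fib_add_two]
  push_cast
  linarith

theorem repetitivity_layeredChain_le_linear [DecidableEq ι] (hδ : 0 < δ) (hη : 0 < η) {T : ℝ}
    (hT : 0 < T) :
    repetitivity (layeredChain i₀ δ η) T ≤
      ENNReal.ofReal ((1 + 2 * δ) * ((φ + 1) * T + 1 / 2) + Fintype.card ι * η) := by
  have hceil := Nat.ceil_pos.2 hT
  have hKT : ((⌈T⌉₊ - 1 : ℕ) : ℝ) < T := by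
    have := Nat.ceil_lt_add_one hT.le
    rw [Nat.cast_sub hceil]
    push_cast
    linarith
  have hTK : T ≤ ((⌈T⌉₊ - 1 : ℕ) : ℝ) + 1 := by
    rw [Nat.cast_sub hceil]
    push_cast
    linarith [Nat.le_ceil T]
  set K := ⌈T⌉₊ - 1
  -- With `n` the greatest index such that `F_n ≤ 2K`, `F_{n+2} ≤ (φ + 1)·2K + 1`; half of this is
  -- the claimed slope.
  refine (repetitivity_layeredChain_le hδ hη hTK
    (Nat.lt_fib_greatestFib_add_one (2 * K))).trans (ENNReal.ofReal_le_ofReal ?_)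
  have h1 := fib_add_two_le (Nat.greatestFib (2 * K))
  have h2 : (Nat.fib (Nat.greatestFib (2 * K)) : ℝ) ≤ 2 * K := by
    exact_mod_cast Nat.fib_greatestFib_le (2 * K)
  have hφ := Real.goldenRatio_pos
  have h3 : (Nat.fib (Nat.greatestFib (2 * K) + 2) : ℝ) ≤ (φ + 1) * (2 * T) + 1 := by
    refine h1.trans ?_
    gcongr
    linarith
  nlinarith

theorem patchCount_layeredChain_le_linear (hδ : 0 < δ) {T : ℝ} (hT : 0 < T) :
    (patchCount (layeredChain i₀ δ η) T : ℝ≥0∞) ≤ ENNReal.ofReal (2 * T + 1) := by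
  have hceil := Nat.ceil_pos.2 hT
  have hKT : ((⌈T⌉₊ - 1 : ℕ) : ℝ) < T := by
    have := Nat.ceil_lt_add_one hT.le
    rw [Nat.cast_sub hceil]
    push_cast
    linarith
  have hTK : T ≤ ((⌈T⌉₊ - 1 : ℕ) : ℝ) + 1 := by
    rw [Nat.cast_sub hceil]
    push_cast
    linarith [Nat.le_ceil T]
  set K := ⌈T⌉₊ - 1
  have h := patchCount_layeredChain_le (i₀ := i₀) (η := η) hδ hTK
  calc (patchCount (layeredChain i₀ δ η) T : ℝ≥0∞) ≤ ((2 * K + 1 : ℕ) : ℕ∞) := by exact_mod_cast h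
    _ = ENNReal.ofReal (2 * K + 1) := by
      rw [ENat.toENNReal_coe, ← ENNReal.ofReal_natCast]
      push_cast
      rfl
    _ ≤ ENNReal.ofReal (2 * T + 1) := ENNReal.ofReal_le_ofReal (by linarith)

end BeattyChain

/-! ### Choice of parameters and conclusion. -/

theorem theorem6p2 (n : ℕ) (hn : 1 ≤ n) (ε : ℝ) (hε : 0 < ε) :
    ∃ X : Set (EuclideanSpace ℝ (Fin n)),
      PointSet.IsMeyer X ∧ ¬ PointSet.IsIdealCrystal X ∧ PointSet.IsLinearlyRepetitive X ∧
      (∃ T : ℝ, 0 < T ∧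
        (PointSet.patchCount X T : ℝ≥0∞) <
          ENNReal.ofReal ((1 / 2 + ε) * (T / (PointSet.coveringRadius X).toReal)) ∧
        PointSet.repetitivity X T < ENNReal.ofReal ((1 / 2 + ε) * T)) ∧
      (∃ T₀ : ℝ, 0 < T₀ ∧ ∀ T : ℝ, T₀ < T →
        (PointSet.patchCount X T : ℝ≥0∞) <
          ENNReal.ofReal ((1 + ε) * (T / (PointSet.coveringRadius X).toReal)) ∧
        PointSet.repetitivity X T < ENNReal.ofReal ((Real.goldenRatio + 1 + ε) * T)) := by
  have hn' : (0 : ℝ) < n := by exact_mod_cast hn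
  obtain ⟨δ, hδ, hδ16, hδε⟩ : ∃ δ : ℝ, 0 < δ ∧ δ ≤ 1 / 16 ∧ δ ≤ ε / 16 :=
    ⟨min 1 ε / 16, by positivity, by linarith [min_le_left 1 ε], by linarith [min_le_right 1 ε]⟩
  -- With spacing `δ / n` the transverse coordinates cost at most `δ` in total.
  have hη : 0 < δ / n := by positivity
  have hnη : (Fintype.card (Fin n) : ℝ) * (δ / n) = δ := by
    rw [Fintype.card_fin]
    field_simp
  set i₀ : Fin n := ⟨0, hn⟩
  set X := BeattyChain.layeredChain i₀ δ (δ / n)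
  have hMeyer : PointSet.IsMeyer X := BeattyChain.isMeyer_layeredChain hδ (by linarith) hη
  have hRup := BeattyChain.coveringRadius_layeredChain_le (i₀ := i₀) hδ hη
  have hRlow := BeattyChain.le_coveringRadius_layeredChain (i₀ := i₀) (η := δ / n) hδ
  rw [hnη] at hRup
  have hRtop : PointSet.coveringRadius X ≠ ⊤ := ne_top_of_le_ne_top ENNReal.ofReal_ne_top hRup
  have hR1 : (1 / 2 : ℝ) ≤ (PointSet.coveringRadius X).toReal :=
    (ENNReal.ofReal_le_iff_le_toReal hRtop).1 hRlow
  have hR2 : (PointSet.coveringRadius X).toReal ≤ 1 / 2 + 2 * δ := by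
    refine (ENNReal.toReal_le_of_le_ofReal (by linarith) hRup).trans (by linarith)
  set R := (PointSet.coveringRadius X).toReal
  have hR0 : 0 < R := by linarith
  have hφ1 := Real.goldenRatio_pos
  have hφ2 := Real.goldenRatio_lt_two
  have hrep : ∀ {T c : ℝ}, 0 < T →
      (1 + 2 * δ) * ((Real.goldenRatio + 1) * T + 1 / 2) + δ < c →
      PointSet.repetitivity X T < ENNReal.ofReal c := fun {T c} hT hc => by
    have h := BeattyChain.repetitivity_layeredChain_le_linear (i₀ := i₀) hδ hη hT
    rw [hnη] at h
    exact h.trans_lt ((ENNReal.ofReal_lt_ofReal_iff (lt_of_le_of_lt (by positivity) hc)).2 hc)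
  refine ⟨X, hMeyer, BeattyChain.not_isIdealCrystal_layeredChain hδ (by linarith) hη,
    ⟨hMeyer.1, 10, fun T hT => hrep (by linarith) ?_⟩, ⟨1, one_pos, ?_, ?_⟩,
    -- Beyond this threshold `εT > 1 + 2ε`, enough to absorb the bounded terms; `δ ≤ ε / 16` absorbs
    -- the linear ones.
    ⟨1 / ε + 2, by positivity, fun T hT => ⟨?_, hrep (lt_trans (by positivity) hT) ?_⟩⟩⟩
  · calc (1 + 2 * δ) * ((Real.goldenRatio + 1) * T + 1 / 2) + δ
        ≤ (1 + 2 * (1 / 16)) * ((2 + 1) * T + 1 / 2) + 1 / 16 := by gcongr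
      _ < 10 * T := by linarith
  · have h := BeattyChain.patchCount_layeredChain_le (i₀ := i₀) (η := δ / n) (K := 0) (T := 1) hδ
      (by simp)
    have h1 : (PointSet.patchCount X 1 : ℝ≥0∞) ≤ 1 := by exact_mod_cast h
    refine h1.trans_lt ?_
    rw [ENNReal.one_lt_ofReal, mul_one_div, one_lt_div hR0]
    linarith
  · have h := BeattyChain.repetitivity_layeredChain_le (i₀ := i₀) (K := 0) (n := 0) (T := 1) hδ hη
      (by simp) (by simp)
    rw [hnη] at h
    refine h.trans_lt ((ENNReal.ofReal_lt_ofReal_iff (by positivity)).2 ?_)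
    simp
    linarith
  · have hT0 : 0 < T := lt_trans (by positivity) hT
    refine (BeattyChain.patchCount_layeredChain_le_linear hδ hT0).trans_lt
      ((ENNReal.ofReal_lt_ofReal_iff (by positivity)).2 ?_)
    rw [mul_div_assoc', lt_div_iff₀ hR0]
    have h1 : 1 < ε * (T - 2) := by
      have := (div_lt_iff₀ hε).1 (show 1 / ε < T - 2 by linarith)
      linarith
    have h2 : (2 * T + 1) * R ≤ (2 * T + 1) * (1 / 2 + 2 * δ) := by gcongr
    have h3 : δ * T ≤ ε / 16 * T := by gcongr
    nlinarith
  · have hT0 : 0 < T := lt_trans (by positivity) hT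
    have h1 : 1 < ε * (T - 2) := by
      have := (div_lt_iff₀ hε).1 (show 1 / ε < T - 2 by linarith)
      linarith
    have h3 : δ * T ≤ ε / 16 * T := by gcongr
    have h4 : Real.goldenRatio * (δ * T) ≤ 2 * (δ * T) := by gcongr
    nlinarith
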